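/- Consider the following $(N,K,L)$ multi-access caching system, where $1\le L\le K\le N$. A server holds $N$ files of $F\ge 1$ bits each, and one file size is the unit of size. There are $K$ users and $K$ caches of size $M\ge 0$ units. User $k$ has access to the $L$ cyclically consecutive caches $k,k+1,\dots,k+L-1$ (indices modulo $K$). An uncoded placement stores in each cache at most $MF$ of the bits of the files, without coding and before the requests are known. Each user $k$ then requests a file $d_k\in\{1,\dots,N\}$, and, depending on $\mathbf d=(d_1,\dots,d_K)$, the server broadcasts to all users an arbitrary function of the files that takes at most $2^{RF}$ values (a message of size $R$ units). The pair $(R,M)$ is achievable under uncoded placement if, for some file size $F$, there is one uncoded placement such that, for every request profile $\mathbf d\in\{1,\dots,N\}^K$, there is a delivery scheme of this kind with which every user $k$ recovers file $d_k$ without error, for all contents of the files, from the broadcast message and the contents of its $L$ caches. Let $R^*(M)$ be the infimum of the rates $R$ for which $(R,M)$ is achievable under uncoded placement. **Theorem.** Suppose that $L\ge K/2$ and let $$R_{lb}(M)=\begin{cases}K-\Big[K-\frac{(K-L)(K-L+1)}{2K}\Big]\frac{MK}{N} & \text{if } 0\le M\le \frac NK,\\[2pt] \frac{(K-L)(K-L+1)}{2K}\Big(2-\frac{MK}{N}\Big)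 & \text{if } \frac NK\le M\le \frac{2N}{K},\\[2pt] 0 & \text{if } M\ge \frac{2N}{K}.\end{cases}$$ Then every uncoded placement with any delivery scheme has rate $R\ge R_{lb}(M)$, that is, $R\ge R_{lb}(M)$ for every achievable pair $(R,M)$, and hence $R^*(M)\ge R_{lb}(M)$. -/

import Mathlib

namespace CCDN

/-- A library of `N` files, each consisting of `F` bits. -/
abbrev Library (N F : ℕ) : Type := Fin N → Fin F → Bool

/-- The caches that user `k` can access: the `L` consecutive caches
`k, k + 1, …, k + L - 1`, with cyclic wrap-around modulo `K`. -/
def accessible (K L : ℕ) (k : Fin K) : Finset (Fin K) :=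
  Finset.univ.filter fun c => ∃ i < L, (c : ℕ) = ((k : ℕ) + i) % K

/-- An uncoded placement of `N` files of `F` bits into `K` caches of size `M` files (`M * F` bits):
each cache stores verbatim some of the bits of the files. The choice of the stored bits is made
before the requests are known. -/
structure UncodedPlacement (N K F : ℕ) (M : ℝ) where
  /-- `(n, b) ∈ store c` says that cache `c` stores bit `b` of file `n`. -/
  store : Fin K → Finset (Fin N × Fin F)
  card_store_le : ∀ c, ((store c).card : ℝ) ≤ M * F

namespace UncodedPlacement

variable {N K F : ℕ} {M : ℝ}

/-- The positions of the bits stored in at least one of the `L` caches that user `k` accesses. -/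
def available (P : UncodedPlacement N K F M) (L : ℕ) (k : Fin K) : Finset (Fin N × Fin F) :=
  (accessible K L k).biUnion P.store

/-- What user `k` reads from its caches when the library is `W`. -/
def sideInfo (P : UncodedPlacement N K F M) (L : ℕ) (k : Fin K) (W : Library N F) :
    {b // b ∈ P.available L k} → Bool :=
  fun b => W b.1.1 b.1.2

end UncodedPlacement

/-- A delivery scheme for the placement `P` and the request profile `d` (user `k` requests file
`d k`), with `q` possible broadcast messages. The message is an arbitrary function of
the library, and every user recovers its file from the message and from its accessible caches,
whatever the content of the library. -/
structure DeliveryScheme {N K F : ℕ} {M : ℝ} (P : UncodedPlacement N K F M) (L : ℕ)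
    (d : Fin K → Fin N) (q : ℕ) where
  encode : Library N F → Fin q
  decode : (k : Fin K) → Fin q → ({b // b ∈ P.available L k} → Bool) → (Fin F → Bool)
  decode_encode : ∀ (W : Library N F) (k : Fin K),
    decode k (encode W) (P.sideInfo L k W) = W (d k)

/-- The rate-memory pair `(R, M)` is achievable with uncoded placement: for some file size `F`
there is one uncoded placement, with caches of size `M` files, such that for every request profile
there is a delivery scheme with a message of size at most `R` files, that is of at most
`R * F` bits. -/
def IsAchievable (N K L : ℕ) (M R : ℝ) : Prop :=
  ∃ F : ℕ, 0 < F ∧ ∃ P : UncodedPlacement N K F M, ∀ d : Fin K → Fin N,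
    ∃ q : ℕ, (q : ℝ) ≤ (2 : ℝ) ^ (R * F) ∧ Nonempty (DeliveryScheme P L d q)

/-- The optimal rate-memory trade-off `R*(M)` under uncoded placement. -/
noncomputable def optimalRate (N K L : ℕ) (M : ℝ) : ℝ :=
  sInf {R : ℝ | IsAchievable N K L M R}

/-- The lower bound `R_lb(M)`. -/
noncomputable def lowerBound (N K L : ℕ) (M : ℝ) : ℝ :=
  if M ≤ (N : ℝ) / K then
    K - (K - ((K : ℝ) - L) * ((K : ℝ) - L + 1) / (2 * K)) * (M * K / N)
  else if M ≤ 2 * (N : ℝ) / K then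
    ((K : ℝ) - L) * ((K : ℝ) - L + 1) / (2 * K) * (2 - M * K / N)
  else 0

end CCDN

/-!
The bound is an averaged cut-set argument. If users are served in some order `u`, let `A` consist of
the bits of the file requested by `u i` that none of the users `u j` with `j ≤ i` can read, for all
`i`. Fix all other bits of the library to zero. Then the broadcast message determines the
bits in `A`: the users decode one after the other, because everything that user `u i` reads is either
zero or belongs to the request of an earlier user. Hence there are at least `2 ^ |A|` messages
(`DeliveryScheme.two_pow_card_le`).

This is averaged over the `K` cyclic orders `s, s + 1, …` of the users and over the `N` cyclic
shifts of a request profile with distinct files. By double counting, `K * N * R * F` is at least the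
sum over all bits of the number of pairs `(s, i)` such that users `s, …, s + i` miss all caches
in the set `S` storing the bit. That number is `K ^ 2` for `S = ∅` and at least
`(K - L) * (K - L + 1) / 2` for `|S| = 1`, so it is bounded below by the two affine functions of
`|S|` that interpolate the values `K ^ 2`, `(K - L) * (K - L + 1) / 2`, `0` at `0, 1, 2`. Summing an
affine decreasing function over all bits only needs the total size of the stored content, which is
at most `K * M * F`.
-/

namespace CCDN

/-! ### Acyclic converse -/

/-- If every bit in `A` belongs to the request of some user `u i` and cannot be read by any of the
users `u j` with `j ≤ i`, then the message distinguishes all values of the bits in `A`. -/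
theorem DeliveryScheme.two_pow_card_le {N K F : ℕ} {M : ℝ} {P : UncodedPlacement N K F M} {L : ℕ}
    {d : Fin K → Fin N} {q : ℕ} (D : DeliveryScheme P L d q)
    {ι : Type*} [LinearOrder ι] [WellFoundedLT ι] (u : ι → Fin K) (A : Finset (Fin N × Fin F))
    (hA : ∀ p ∈ A, ∃ i, p.1 = d (u i) ∧ ∀ j ≤ i, p ∉ P.available L (u j)) :
    2 ^ A.card ≤ q := by
  classical
  -- The library with content `x` on `A` and zeros elsewhere.
  let lib : (A → Bool) → Library N F := fun x n b => if h : (n, b) ∈ A then x ⟨(n, b), h⟩ else false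
  have hinj : Function.Injective fun x => D.encode (lib x) := by
    intro x y hxy
    have hfile : ∀ i, lib x (d (u i)) = lib y (d (u i)) := by
      intro i
      induction i using WellFoundedLT.induction with
      | ind i ih =>
        have hside : P.sideInfo L (u i) (lib x) = P.sideInfo L (u i) (lib y) := by
          funext ⟨⟨n, b⟩, hp⟩
          change lib x n b = lib y n b
          by_cases h : (n, b) ∈ A
          · obtain ⟨i', hn, hmiss⟩ := hA _ h
            have hlt : i' < i := by
              by_contra hle
              exact hmiss i (not_lt.mp hle) hp
            have hn' : n = d (u i') := hn
            rw [hn', ih i' hlt]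
          · simp [lib, h]
        have hx := D.decode_encode (lib x) (u i)
        have hy := D.decode_encode (lib y) (u i)
        have hxy' : D.encode (lib x) = D.encode (lib y) := hxy
        rw [← hx, ← hy, hside, hxy']
    funext ⟨⟨n, b⟩, hp⟩
    obtain ⟨i, hn, -⟩ := hA _ hp
    have hn' : n = d (u i) := hn
    have := congrFun (hfile i) b
    rw [← hn'] at this
    simpa [lib, hp] using this
  simpa using Fintype.card_le_of_injective _ hinj

/-! ### Users missing a set of caches -/

/-- The pairs `(s, i)` such that none of the cyclically consecutive users `s, s + 1, …, s + i`
accesses a cache in `S`. -/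
def missing (K L : ℕ) [NeZero K] (S : Finset (Fin K)) : Finset (Fin K × Fin K) :=
  Finset.univ.filter fun x => ∀ j ≤ x.2, Disjoint S (accessible K L (x.1 + j))

theorem card_missing_empty (K L : ℕ) [NeZero K] : (missing K L ∅).card = K ^ 2 := by
  simp [missing, sq]

theorem notMem_accessible_of_add_le {K L : ℕ} [NeZero K] {c s i j : Fin K}
    (h : (i : ℕ) + L ≤ (c - s : Fin K)) (hj : j ≤ i) : c ∉ accessible K L (s + j) := by
  intro hc
  obtain ⟨l, hl, hcl⟩ : ∃ l < L, (c : ℕ) = ((s + j : Fin K) + l) % K := by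
    simpa [accessible] using hc
  have hj' : (j : ℕ) ≤ i := hj
  have hm : (c - s : Fin K).val < K := (c - s).isLt
  -- `c` is `j + l` steps after `s`, and `j + l < K`, so `c - s` is `j + l`.
  have hsum : c = s + ⟨j + l, by omega⟩ := by
    apply Fin.ext
    rw [hcl, Fin.val_add, Fin.val_add, Nat.mod_add_mod, add_assoc]
  have : (c - s : Fin K) = ⟨j + l, by omega⟩ := sub_eq_of_eq_add' hsum
  have := congrArg Fin.val this
  simp only at this
  omega

theorem two_mul_sum_range_add_one_sub {K L : ℕ} (hLK : L ≤ K) :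
    2 * ∑ m ∈ Finset.range K, (m + 1 - L) = (K - L) * (K - L + 1) := by
  obtain ⟨n, rfl⟩ := Nat.exists_eq_add_of_le hLK
  rw [Finset.sum_range_add, Finset.sum_eq_zero, zero_add]
  · have h : ∀ x ∈ Finset.range n, L + x + 1 - L = x + 1 := fun x _ => by omega
    rw [Finset.sum_congr rfl h, add_tsub_cancel_left]
    induction n with
    | zero => rfl
    | succ n ih =>
      rw [Finset.sum_range_succ, mul_add, ih (by omega) (fun x _ => by omega)]
      ring
  · intro x hx
    have := Finset.mem_range.mp hx
    omega

theorem le_two_mul_card_missing_singleton {K L : ℕ} [NeZero K] (hL : 1 ≤ L) (hLK : L ≤ K)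
    (c : Fin K) : (K - L) * (K - L + 1) ≤ 2 * (missing K L {c}).card := by
  have hsub : (Finset.univ.filter fun x : Fin K × Fin K => (x.2 : ℕ) + L ≤ (c - x.1 : Fin K)) ⊆
      missing K L {c} := by
    intro x hx
    simp only [Finset.mem_filter, Finset.mem_univ, true_and] at hx
    simp only [missing, Finset.mem_filter, Finset.mem_univ, true_and,
      Finset.disjoint_singleton_left]
    exact fun j hj => notMem_accessible_of_add_le hx hj
  refine le_trans (le_of_eq ?_) (Nat.mul_le_mul_left 2 (Finset.card_le_card hsub))
  rw [← two_mul_sum_range_add_one_sub hLK, Finset.card_filter, Fintype.sum_prod_type,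
    ← Fin.sum_univ_eq_sum_range (fun m => m + 1 - L) K, ← (Equiv.subLeft c).sum_comp]
  congr 1
  refine Finset.sum_congr rfl fun s _ => ?_
  generalize hm : (Equiv.subLeft c) s = m
  have hm' : c - s = m := hm
  have hlt := m.isLt
  simp only [hm']
  rw [Fin.sum_univ_eq_sum_range (fun i => if i + L ≤ (m : ℕ) then 1 else 0) K,
    ← Finset.card_filter]
  have : (Finset.range K).filter (fun i => i + L ≤ (m : ℕ)) = Finset.range (m + 1 - L) := by
    ext i
    simp only [Finset.mem_filter, Finset.mem_range]
    omega
  rw [this, Finset.card_range]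

/-- The line through the values at `|S| = 0` and `|S| = 1`. -/
theorem le_card_missing_of_small {K L : ℕ} [NeZero K] (hL : 1 ≤ L) (hLK : L ≤ K)
    (S : Finset (Fin K)) :
    (K : ℝ) ^ 2 - ((K : ℝ) ^ 2 - ((K : ℝ) - L) * ((K : ℝ) - L + 1) / 2) * S.card ≤
      (missing K L S).card := by
  have hL' : (1 : ℝ) ≤ L := by exact_mod_cast hL
  have hLK' : (L : ℝ) ≤ K := by exact_mod_cast hLK
  rcases lt_trichotomy S.card 1 with h | h | h
  · obtain rfl : S = ∅ := Finset.card_eq_zero.mp (by omega)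
    simp [card_missing_empty]
  · obtain ⟨c, rfl⟩ := Finset.card_eq_one.mp h
    have := le_two_mul_card_missing_singleton hL hLK c
    have h' : (((K - L) * (K - L + 1) : ℕ) : ℝ) ≤ (2 * (missing K L {c}).card : ℕ) := by
      exact_mod_cast this
    push_cast [Nat.cast_sub hLK] at h'
    rw [Finset.card_singleton, Nat.cast_one]
    linarith
  · have h2 : (2 : ℝ) ≤ S.card := by exact_mod_cast h
    have h0 : (0 : ℝ) ≤ (missing K L S).card := Nat.cast_nonneg _
    have hγ : ((K : ℝ) - L) * ((K : ℝ) - L + 1) ≤ (K : ℝ) ^ 2 := by nlinarith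
    nlinarith

/-- The line through the values at `|S| = 1` and `|S| = 2`. -/
theorem le_card_missing_of_large {K L : ℕ} [NeZero K] (hL : 1 ≤ L) (hLK : L ≤ K)
    (S : Finset (Fin K)) :
    ((K : ℝ) - L) * ((K : ℝ) - L + 1) / 2 * (2 - S.card) ≤ (missing K L S).card := by
  have hL' : (1 : ℝ) ≤ L := by exact_mod_cast hL
  have hLK' : (L : ℝ) ≤ K := by exact_mod_cast hLK
  have hγ0 : 0 ≤ ((K : ℝ) - L) * ((K : ℝ) - L + 1) := by
    apply mul_nonneg <;> linarith
  rcases le_or_gt S.card 1 with h | h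
  · have h1 : (S.card : ℝ) ≤ 1 := by exact_mod_cast h
    have hγ : ((K : ℝ) - L) * ((K : ℝ) - L + 1) ≤ (K : ℝ) ^ 2 := by nlinarith
    refine le_trans ?_ (le_card_missing_of_small hL hLK S)
    nlinarith
  · have h2 : (2 : ℝ) ≤ S.card := by exact_mod_cast h
    refine le_trans ?_ (Nat.cast_nonneg _)
    nlinarith

/-! ### Averaging over user orders and requests -/

/-- The set of caches storing the bit `p`. -/
def UncodedPlacement.holders {N K F : ℕ} {M : ℝ} (P : UncodedPlacement N K F M)
    (p : Fin N × Fin F) : Finset (Fin K) :=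
  Finset.univ.filter fun c => p ∈ P.store c

theorem UncodedPlacement.notMem_available_iff {N K F : ℕ} {M : ℝ} (P : UncodedPlacement N K F M)
    (L : ℕ) (k : Fin K) (p : Fin N × Fin F) :
    p ∉ P.available L k ↔ Disjoint (P.holders p) (accessible K L k) := by
  simp only [available, holders, Finset.mem_biUnion, not_exists, not_and, Finset.disjoint_left,
    Finset.mem_filter, Finset.mem_univ, true_and]
  exact ⟨fun h c hc hk => h c hk hc, fun h c hk hc => h hc hk⟩

theorem UncodedPlacement.sum_card_holders_le {N K F : ℕ} {M : ℝ} (P : UncodedPlacement N K F M) :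
    ∑ p, ((P.holders p).card : ℝ) ≤ K * M * F := by
  have hcomm : ∑ p, (P.holders p).card = ∑ c, (P.store c).card := by
    simp only [holders, Finset.card_filter]
    rw [Finset.sum_comm]
    simp
  calc ∑ p, ((P.holders p).card : ℝ) = ∑ c, ((P.store c).card : ℝ) := by exact_mod_cast hcomm
    _ ≤ ∑ _c : Fin K, M * F := Finset.sum_le_sum fun c _ => P.card_store_le c
    _ = K * M * F := by simp [mul_assoc]

/-- The acyclic converse averaged over the `K` cyclic orders of the users and the `N` cyclic shifts
of the profile in which user `k` requests file `k`. -/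
theorem sum_card_missing_le {N K L F : ℕ} [NeZero K] [NeZero N] {M R : ℝ} (hKN : K ≤ N)
    (P : UncodedPlacement N K F M)
    (hP : ∀ d : Fin K → Fin N,
      ∃ q : ℕ, (q : ℝ) ≤ (2 : ℝ) ^ (R * F) ∧ Nonempty (DeliveryScheme P L d q)) :
    ∑ p, ((missing K L (P.holders p)).card : ℝ) ≤ K * N * (R * F) := by
  classical
  let A : Fin K → Fin N → Finset (Fin N × Fin F) := fun s t => Finset.univ.filter fun p =>
    ∃ i, p.1 = t + Fin.castLE hKN (s + i) ∧ (s, i) ∈ missing K L (P.holders p)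
  have hA : ∀ s t, ((A s t).card : ℝ) ≤ R * F := by
    intro s t
    obtain ⟨q, hq, ⟨D⟩⟩ := hP fun k => t + Fin.castLE hKN k
    have h : 2 ^ (A s t).card ≤ q := by
      refine D.two_pow_card_le (fun i : Fin K => s + i) _ fun p hp => ?_
      obtain ⟨i, hi, hmiss⟩ := (Finset.mem_filter.mp hp).2
      exact ⟨i, hi, fun j hj =>
        (P.notMem_available_iff L _ p).mpr ((Finset.mem_filter.mp hmiss).2 j hj)⟩
    have h' : (2 : ℝ) ^ ((A s t).card : ℝ) ≤ 2 ^ (R * F) := by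
      rw [Real.rpow_natCast]
      exact le_trans (by exact_mod_cast h) hq
    exact (Real.rpow_le_rpow_left_iff one_lt_two).mp h'
  -- For given `s` and `p`, the shift under which user `s + i` requests the file of `p`
  -- determines `i`, since the requested files are distinct.
  have hshift : ∀ p s, (Finset.univ.filter fun i => (s, i) ∈ missing K L (P.holders p)).card ≤
      (Finset.univ.filter fun t => p ∈ A s t).card := by
    intro p s
    refine Finset.card_le_card_of_injOn (fun i => p.1 - Fin.castLE hKN (s + i)) ?_ ?_
    · intro i hi
      have hi' : (s, i) ∈ missing K L (P.holders p) := by simpa using hi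
      simp only [Finset.coe_filter, Set.mem_ofPred_eq, Finset.mem_univ, true_and, A,
        Finset.mem_filter]
      exact ⟨i, by abel, hi'⟩
    · intro i _ j _ hij
      exact add_left_cancel (Fin.castLE_injective hKN (sub_right_injective hij))
  have hcount : ∑ p, (missing K L (P.holders p)).card ≤ ∑ s, ∑ t, (A s t).card := by
    calc ∑ p, (missing K L (P.holders p)).card
        = ∑ p, ∑ s, (Finset.univ.filter fun i => (s, i) ∈ missing K L (P.holders p)).card := by
          refine Finset.sum_congr rfl fun p _ => ?_
          simp only [Finset.card_filter]
          rw [← Fintype.sum_prod_type fun x => if x ∈ missing K L (P.holders p) then 1 else 0]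
          simp
      _ ≤ ∑ p, ∑ s, (Finset.univ.filter fun t => p ∈ A s t).card :=
          Finset.sum_le_sum fun p _ => Finset.sum_le_sum fun s _ => hshift p s
      _ = ∑ s, ∑ t, (A s t).card := by
          rw [Finset.sum_comm]
          refine Finset.sum_congr rfl fun s _ => ?_
          simp only [Finset.card_filter]
          rw [Finset.sum_comm]
          simp
  calc ∑ p, ((missing K L (P.holders p)).card : ℝ) ≤ ∑ s, ∑ t, ((A s t).card : ℝ) := by
        exact_mod_cast hcount
    _ ≤ ∑ _s : Fin K, ∑ _t : Fin N, R * F :=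
        Finset.sum_le_sum fun s _ => Finset.sum_le_sum fun t _ => hA s t
    _ = K * N * (R * F) := by simp [mul_assoc]

/-- A decreasing affine lower bound on the number of missing pairs, in terms of the number of
caches storing a bit, gives a lower bound on the rate. -/
theorem IsAchievable.le_of_affine {N K L : ℕ} [NeZero K] [NeZero N] {M R a b : ℝ} (hKN : K ≤ N)
    (h : IsAchievable N K L M R) (hb : 0 ≤ b)
    (hab : ∀ S : Finset (Fin K), a - b * S.card ≤ (missing K L S).card) :
    a * N - b * (K * M) ≤ K * N * R := by
  obtain ⟨F, hF, P, hP⟩ := h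
  have hF' : (0 : ℝ) < F := by exact_mod_cast hF
  have h1 := sum_card_missing_le hKN P hP
  have h2 : ∑ p, (a - b * ((P.holders p).card : ℝ)) ≤
      ∑ p, ((missing K L (P.holders p)).card : ℝ) :=
    Finset.sum_le_sum fun p _ => hab _
  have h3 : ∑ p : Fin N × Fin F, (a - b * ((P.holders p).card : ℝ)) =
      a * N * F - b * ∑ p, ((P.holders p).card : ℝ) := by
    rw [Finset.sum_sub_distrib, ← Finset.mul_sum]
    simp
    ring
  have h4 := mul_le_mul_of_nonneg_left P.sum_card_holders_le hb
  refine le_of_mul_le_mul_right ?_ hF'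
  linarith

theorem lowerBound_le_of_isAchievable {N K L : ℕ} {M R : ℝ} (hL : 1 ≤ L) (hLK : L ≤ K)
    (hKN : K ≤ N) (h : IsAchievable N K L M R) : lowerBound N K L M ≤ R := by
  have : NeZero K := ⟨by omega⟩
  have : NeZero N := ⟨by omega⟩
  have hK : (0 : ℝ) < K := by exact_mod_cast (by omega : 0 < K)
  have hN : (0 : ℝ) < N := by exact_mod_cast (by omega : 0 < N)
  have hL' : (1 : ℝ) ≤ L := by exact_mod_cast hL
  have hLK' : (L : ℝ) ≤ K := by exact_mod_cast hLK
  have hγ0 : 0 ≤ ((K : ℝ) - L) * ((K : ℝ) - L + 1) / 2 := by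
    apply div_nonneg (mul_nonneg _ _) <;> linarith
  have hγ : ((K : ℝ) - L) * ((K : ℝ) - L + 1) / 2 ≤ (K : ℝ) ^ 2 := by nlinarith
  have hKN' := mul_pos hK hN
  unfold lowerBound
  split_ifs
  · have := h.le_of_affine hKN (sub_nonneg.mpr hγ) (le_card_missing_of_small hL hLK)
    refine le_of_mul_le_mul_left (le_trans (le_of_eq ?_) this) hKN'
    field_simp
  · have := h.le_of_affine (a := ((K : ℝ) - L) * ((K : ℝ) - L + 1) / 2 * 2) hKN hγ0
      fun S => by simpa only [mul_sub] using le_card_missing_of_large hL hLK S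
    refine le_of_mul_le_mul_left (le_trans (le_of_eq ?_) this) hKN'
    field_simp
  · have := h.le_of_affine (a := 0) hKN le_rfl fun S => by simp
    refine le_of_mul_le_mul_left (le_trans (le_of_eq ?_) this) hKN'
    ring

/-- Broadcasting the whole library, with empty caches, achieves the rate `N`. -/
theorem isAchievable_natCast (N K L : ℕ) {M : ℝ} (hM : 0 ≤ M) : IsAchievable N K L M N := by
  refine ⟨1, one_pos, ⟨fun _ => ∅, fun _ => by simpa using hM⟩, fun d => ?_⟩
  let e := Fintype.equivFin (Library N 1)
  refine ⟨Fintype.card (Library N 1), ?_, ⟨⟨e, fun k m _ => e.symm m (d k), fun W k => ?_⟩⟩⟩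
  · simp [Library]
  · simp

end CCDN

theorem theorem2 (N K L : ℕ) (M : ℝ) (hL : 1 ≤ L) (hLK : L ≤ K) (hKN : K ≤ N)
    (hKL : K ≤ 2 * L) (hM : 0 ≤ M) :
    (∀ R : ℝ, CCDN.IsAchievable N K L M R → CCDN.lowerBound N K L M ≤ R) ∧
      CCDN.lowerBound N K L M ≤ CCDN.optimalRate N K L M := by
  have h : ∀ R : ℝ, CCDN.IsAchievable N K L M R → CCDN.lowerBound N K L M ≤ R :=
    fun _ hR => CCDN.lowerBound_le_of_isAchievable hL hLK hKN hR
  -- Some rate is achievable, so the infimum is not the junk value of `sInf ∅`.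
  exact ⟨h, le_csInf ⟨N, CCDN.isAchievable_natCast N K L hM⟩ h⟩
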